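/- All wedges below are closed convex cones of angle $2\pi/3$ in the Euclidean plane, apex included; the orientation of a wedge is the orientation (counterclockwise angle from the positive $x$-axis) of its bisector ray. If every point $p$ of a set $S$ carries such a wedge $W_p$ with apex $p$, the graph induced by $S$ has vertex set $S$ and an edge between distinct $p,q\in S$ if and only if $p\in W_q$ and $q\in W_p$. Gadget orientation of a triplet. Let $S$ be a set of three distinct points. Label $S=\{a,b,c\}$ so that the angles of the (possibly degenerate) triangle $abc$ satisfy $\angle b\le\angle c\le\angle a$; if the points are collinear (so that $\angle b=\angle c=0$ and $\angle a=\pi$), choose the labels of the end points so that moreover $|ac|\le|ab|$. Ties may be broken arbitrarily. Draw the triangle, by an isometry of the plane (reflections allowed), so that $\overline{bc}$ is horizontal with $b$ to the left of $c$, and $a$ is not below the line through $b$ and $c$. In this drawing give the wedges at $a$, $b$, $c$ the orientations $240^\circ$, $0^\circ$, $120^\circ$, respectively, and carry the wedges back by the isometry. Any orientation of the wedges of $S$ obtained in this way is called a gadget orientation of $S$. Theorem. Let $S_1$ and $S_2$ be two triplets of points in the plane, let each point of $S_1\cup S_2$ carry a wedge of angle $2\pi/3$, and suppose that the wedges of $S_1$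 form a gadget orientation of $S_1$ and, independently, the wedges of $S_2$ form a gadget orientation of $S_2$. Then the graph induced by $S_1\cup S_2$ is connected. Moreover, there are $p\in S_1$ and $q\in S_2$ such that $p$ lies in the wedge of $q$ and $q$ lies in the wedge of $p$. -/

import Mathlib

open Real EuclideanGeometry

/-- The Euclidean plane. -/
abbrev Plane : Type := EuclideanSpace ℝ (Fin 2)

/-- The unit vector of orientation `t`, in radians, counterclockwise from the positive first axis. -/
noncomputable def dir (t : ℝ) : Plane := !₂[Real.cos t, Real.sin t]

/-- The closed wedge of angle `α` and apex `p` whose bisector has orientation `t`. -/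
def wedge (α : ℝ) (p : Plane) (t : ℝ) : Set Plane :=
  {q | q = p ∨ InnerProductGeometry.angle (dir t) (q - p) ≤ α / 2}

/-- The graph induced by the point set `S` when each point `p` carries the wedge of angle `α`
and orientation `θ p`: two different points are joined when each lies in the wedge of the other. -/
def inducedGraph (α : ℝ) (S : Set Plane) (θ : Plane → ℝ) : SimpleGraph S where
  Adj p q := p ≠ q ∧ (p : Plane) ∈ wedge α q (θ q) ∧ (q : Plane) ∈ wedge α p (θ p)
  symm := ⟨fun _ _ h => ⟨h.1.symm, h.2.2, h.2.1⟩⟩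
  loopless := ⟨fun _ h => h.1 rfl⟩

/-- `a, b, c` are distinct and the angles of the (possibly degenerate) triangle at these vertices
satisfy `∠b ≤ ∠c ≤ ∠a`. When the points are collinear this makes `a` the middle one and leaves
`b` and `c` undetermined, and then `c` is an end point nearest to `a`. -/
structure IsGadgetLabelling (a b c : Plane) : Prop where
  ab : a ≠ b
  bc : b ≠ c
  ac : a ≠ c
  angle_b_le_angle_c : ∠ a b c ≤ ∠ a c b
  angle_c_le_angle_a : ∠ a c b ≤ ∠ b a c
  degenerate : Collinear ℝ {a, b, c} → dist a c ≤ dist a b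

/-- The isometry `e` of the plane (a rigid motion or a reflected one) draws the triangle `abc`
with `bc` horizontal, `b` to the left of `c`, and `a` not below the line through `b` and `c`. -/
structure IsGadgetDrawing (e : Plane ≃ᵃⁱ[ℝ] Plane) (a b c : Plane) : Prop where
  horizontal : e b 1 = e c 1
  left : e b 0 < e c 0
  not_below : e b 1 ≤ e a 1

/-- The wedges of the triplet `S`, of orientations `θ`, are oriented by the gadget construction:
in the drawing, the orientations at `a`, `b`, `c` are 240, 0 and 120 degrees. -/
def IsGadgetOriented (S : Set Plane) (θ : Plane → ℝ) : Prop :=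
  ∃ a b c : Plane, S = {a, b, c} ∧ IsGadgetLabelling a b c ∧
    ∃ e : Plane ≃ᵃⁱ[ℝ] Plane, IsGadgetDrawing e a b c ∧
      e.linearIsometryEquiv (dir (θ a)) = dir (4 * π / 3) ∧
      e.linearIsometryEquiv (dir (θ b)) = dir 0 ∧
      e.linearIsometryEquiv (dir (θ c)) = dir (2 * π / 3)

/-! ### Two systems of three half-planes -/

/-! A wedge of angle 120° is cut out by two half-planes whose normals differ by 120°. A
gadget-oriented triplet is therefore a cyclic system, `IsFan`: consecutive wedges overlap, and the
three cyclic sums of support values, which add up to zero, are ordered (`exists_isFan`). These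
inequalities are all that is used of the triangle, apart from `b` seeing and being seen by both
other points, which leaves a single link between the triplets to be found.

For two fans, reverse the normals of the second and relabel it cyclically until the six directions
interleave as `n 0, f 0, n 1, f 1, n 2, f 2` (`exists_mutual`). If no pair sees each other, the
pairs of indices `(k, k)` and `(k + 1, k)` give implications between strict comparisons. Chained
with the overlaps, they run around the cycle, so each comparison points the same way for all `k`.
Summing over `k` leaves two strict inequalities between cyclic sums, which `false_of_mixed_bounds`
refutes. -/

section Core

variable {V : Type*} [NormedAddCommGroup V] [InnerProductSpace ℝ V]

/-- A step up in the cyclic order of three truth values propagates to all of them. -/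
theorem forall_fin_three_of_step {P : Fin 3 → Prop} (step : ∀ k, P k → P (k + 1)) {k : Fin 3}
    (hk : P k) (j : Fin 3) : P j := by
  have h₁ := step _ hk
  have h₂ := step _ h₁
  fin_cases k <;> fin_cases j <;> first | exact hk | exact h₁ | exact h₂

/-- The quadratic inequality behind the two summation arguments. -/
theorem false_of_mixed_bounds {r s x y : ℝ} (hrs : r ^ 2 + s ^ 2 - r * s = 1)
    (hx : 0 ≤ x) (hy : 0 ≤ y)
    (h₁ : y < (2 * s - r) * x) (h₂ : x < (2 * r - s) * y) : False := by
  have hx' : 0 < x := by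
    rcases hx.eq_or_lt with h | h
    · subst h; linarith
    · exact h
  have hy' : 0 < y := by
    rcases hy.eq_or_lt with h | h
    · subst h; linarith
    · exact h
  have h₃ : 0 < 2 * s - r := pos_of_mul_pos_left (hy'.trans h₁) hx
  have h₄ : y < (2 * s - r) * ((2 * r - s) * y) := h₁.trans (mul_lt_mul_of_pos_left h₂ h₃)
  have h₅ : 1 < (2 * s - r) * (2 * r - s) := by
    by_contra! h
    nlinarith [mul_le_mul_of_nonneg_right h hy]
  -- By `hrs`, the product is `3rs - 2`, and `(r - s)² = 1 - rs ≥ 0` bounds it by 1.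
  nlinarith [sq_nonneg (r - s)]

/-- Let `n` and `f` be two triples of vectors of a plane, each one a triple of directions spaced
by 120 degrees, interleaved in the cyclic order, and let `p` and `q` be triples of points. If
consecutive sectors overlap and the cyclic sums of support values are ordered as stated, some
difference `q j - p k` lies in the intersection of the `k`-th sector of `n` and the `j`-th
sector of `f`. -/
theorem exists_mem_sectors {n f p q : Fin 3 → V} {r s : ℝ}
    (hrs : r ^ 2 + s ^ 2 - r * s = 1) (hr : 0 < r) (hs : 0 ≤ s)
    (hn : n 0 + n 1 + n 2 = 0) (hf : ∀ k, f k = r • n k + s • n (k + 1))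
    (hp : ∀ k, inner ℝ (n (k + 1)) (p k) ≤ inner ℝ (n (k + 1)) (p (k + 1)))
    (hq : ∀ k, inner ℝ (f (k + 1)) (q (k + 1)) ≤ inner ℝ (f (k + 1)) (q k))
    (hp₁ : ∑ k, inner ℝ (n (k + 1)) (p k) ≤ ∑ k, inner ℝ (n (k + 2)) (p k))
    (hp₂ : ∑ k, inner ℝ (n (k + 2)) (p k) ≤ ∑ k, inner ℝ (n k) (p k))
    (hq₁ : ∑ k, inner ℝ (f (k + 2)) (q k) ≤ ∑ k, inner ℝ (f (k + 1)) (q k))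
    (hq₂ : ∑ k, inner ℝ (f k) (q k) ≤ ∑ k, inner ℝ (f (k + 2)) (q k)) :
    ∃ k j, inner ℝ (n k) (q j - p k) ≤ 0 ∧ 0 ≤ inner ℝ (n (k + 1)) (q j - p k) ∧
      inner ℝ (f j) (q j - p k) ≤ 0 ∧ 0 ≤ inner ℝ (f (j + 1)) (q j - p k) := by
  have hn' : ∀ k v, inner ℝ (n k) v + inner ℝ (n (k + 1)) v + inner ℝ (n (k + 2)) v = 0 := by
    intro k v
    have h : inner ℝ (n 0 + n 1 + n 2) v = 0 := by rw [hn, inner_zero_left]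
    simp only [inner_add_left] at h
    fin_cases k <;> simp <;> linarith
  have hf' : ∀ k v, inner ℝ (f k) v = r * inner ℝ (n k) v + s * inner ℝ (n (k + 1)) v := by
    intro k v
    rw [hf, inner_add_left, real_inner_smul_left, real_inner_smul_left]
  have hnf : ∀ k v, inner ℝ (n (k + 1)) v =
      s * inner ℝ (f k) v + r * inner ℝ (f (k + 1)) v := by
    intro k v
    have e : k + 1 + 1 = k + 2 := by fin_cases k <;> rfl
    rw [hf', hf', e]
    linear_combination (-inner ℝ (n (k + 1)) v) * hrs - r * s * hn' k v
  have e2 : ∀ k : Fin 3, k + 1 + 1 = k + 2 := by decide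
  by_contra! H
  -- For the pair `p k`, `q k`, the two conditions from `f k` and `n (k + 1)` imply the other two,
  -- because these directions are the inner ones of the four.
  have odd : ∀ k, inner ℝ (f k) (q k - p k) ≤ 0 → inner ℝ (n (k + 1)) (q k - p k) < 0 := by
    intro k h
    by_contra! h'
    refine absurd (H k k ?_ h' h) (not_lt.2 ?_)
    · have := hf' k (q k - p k)
      nlinarith [mul_nonneg hs h']
    · have := hnf k (q k - p k)
      nlinarith
  -- The same for `p (k + 1)`, `q k`, with inner directions `n (k + 1)` and `f (k + 1)`; recovering
  -- the sign for `f k` divides by `s`.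
  have even : 0 < s → ∀ k, inner ℝ (n (k + 1)) (q k - p (k + 1)) ≤ 0 →
      inner ℝ (f (k + 1)) (q k - p (k + 1)) < 0 := by
    intro hs k h
    by_contra! h'
    refine absurd (H (k + 1) k h ?_ ?_) (not_lt.2 h')
    · have := hf' (k + 1) (q k - p (k + 1))
      nlinarith
    · have := hnf k (q k - p (k + 1))
      nlinarith [mul_nonneg hr.le h']
  simp only [inner_sub_right, sub_nonpos, sub_neg] at odd even
  set X₀ := ∑ k, inner ℝ (n k) (p k) with hX₀
  set X₁ := ∑ k, inner ℝ (n (k + 1)) (p k) with hX₁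
  set X₂ := ∑ k, inner ℝ (n (k + 2)) (p k) with hX₂
  set Y₀ := ∑ k, inner ℝ (f k) (q k) with hY₀
  set Y₁ := ∑ k, inner ℝ (f (k + 1)) (q k) with hY₁
  set Y₂ := ∑ k, inner ℝ (f (k + 2)) (q k) with hY₂
  have hX : X₀ + X₁ + X₂ = 0 := by
    rw [hX₀, hX₁, hX₂, ← Finset.sum_add_distrib, ← Finset.sum_add_distrib]
    exact Finset.sum_eq_zero fun k _ => hn' k _
  have hfsum : ∀ k v, inner ℝ (f k) v + inner ℝ (f (k + 1)) v + inner ℝ (f (k + 2)) v = 0 := by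
    intro k v
    have e3 : k + 2 + 1 = k := by fin_cases k <;> rfl
    rw [hf', hf', hf', e2, e3]
    linear_combination (r + s) * hn' k v
  have hY : Y₀ + Y₁ + Y₂ = 0 := by
    rw [hY₀, hY₁, hY₂, ← Finset.sum_add_distrib, ← Finset.sum_add_distrib]
    exact Finset.sum_eq_zero fun k _ => hfsum k _
  have hfp : ∑ k, inner ℝ (f k) (p k) = r * X₀ + s * X₁ := by
    simp only [hf', Finset.sum_add_distrib, Finset.mul_sum, hX₀, hX₁]
  have hfp' : ∑ k, inner ℝ (f (k + 1)) (p (k + 1)) = r * X₀ + s * X₁ := by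
    rw [← hfp]; exact Equiv.sum_comp (Equiv.addRight (1 : Fin 3)) fun k => inner ℝ (f k) (p k)
  have hnp' : ∑ k, inner ℝ (n (k + 1)) (p (k + 1)) = X₀ := by
    exact Equiv.sum_comp (Equiv.addRight (1 : Fin 3)) fun k => inner ℝ (n k) (p k)
  have hnq : ∑ k, inner ℝ (n (k + 1)) (q k) = s * Y₀ + r * Y₁ := by
    simp only [hnf, Finset.sum_add_distrib, Finset.mul_sum, hY₀, hY₁]
  have sum_lt : ∀ {a b : Fin 3 → ℝ}, (∀ k, a k < b k) → ∑ k, a k < ∑ k, b k := fun h =>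
    Finset.sum_lt_sum_of_nonempty Finset.univ_nonempty fun k _ => h k
  -- If `s = 0`, the two triples of directions coincide and `odd` alone closes the cycle.
  rcases hs.eq_or_lt with rfl | hs'
  · have hr1 : r = 1 := by nlinarith
    subst hr1
    have hfn : ∀ k v, inner ℝ (f k) v = inner ℝ (n k) v := by intro k v; rw [hf']; ring
    by_cases hL : ∃ k, inner ℝ (f k) (q k) ≤ inner ℝ (f k) (p k)
    · obtain ⟨k, hk⟩ := hL
      have all := forall_fin_three_of_step
        (P := fun k => inner ℝ (f k) (q k) ≤ inner ℝ (f k) (p k)) (fun k h => by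
          have h₁ := odd k h
          have h₂ := hp k
          have h₃ := hq k
          simp only [hfn] at h₃ ⊢
          linarith) hk
      have := sum_lt fun k => odd k (all k)
      linarith
    · push Not at hL
      have := sum_lt hL
      linarith
  · have even := even hs'
    by_cases hL : ∃ k, inner ℝ (f k) (q k) ≤ inner ℝ (f k) (p k)
    · obtain ⟨k, hk⟩ := hL
      have oe : ∀ k, inner ℝ (f k) (q k) ≤ inner ℝ (f k) (p k) →
          inner ℝ (f (k + 1)) (q k) < inner ℝ (f (k + 1)) (p (k + 1)) := fun k h =>
        even k ((odd k h).le.trans (hp k))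
      have all := forall_fin_three_of_step
        (P := fun k => inner ℝ (f k) (q k) ≤ inner ℝ (f k) (p k)) (fun k h =>
          (hq k).trans (oe k h).le) hk
      have h₁ := sum_lt fun k => odd k (all k)
      have h₂ := sum_lt fun k => oe k (all k)
      rw [hnq] at h₁
      rw [hfp'] at h₂
      -- As each triple of sums is zero, `2 * Y₁ + Y₀ = Y₁ - Y₂` and `-(2 * X₁) - X₀ = X₂ - X₁`;
      -- this eliminates `Y₀` and `X₀`.
      have h₃ : 0 ≤ s * (2 * Y₁ + Y₀) := mul_nonneg hs (by linarith)
      have h₄ : 0 ≤ r * (-(2 * X₁) - X₀) := mul_nonneg hr.le (by linarith)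
      exact false_of_mixed_bounds (x := Y₁) (y := -X₁) hrs (by linarith) (by linarith)
        (by linarith) (by linarith)
    · push Not at hL
      have h₁ := sum_lt hL
      have h₂ : ∀ k, inner ℝ (n (k + 1)) (p (k + 1)) < inner ℝ (n (k + 1)) (q k) := by
        intro k
        by_contra! h
        have := even k h
        have := hq k
        have := hL (k + 1)
        linarith
      have h₃ := sum_lt h₂
      rw [hfp] at h₁
      rw [hnq, hnp'] at h₃
      have h₄ : 0 ≤ s * (X₁ + 2 * X₀) := mul_nonneg hs (by linarith)
      have h₅ : 0 ≤ r * (-(2 * Y₀) - Y₁) := mul_nonneg hr.le (by linarith)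
      exact false_of_mixed_bounds (x := X₀) (y := -Y₀) hrs (by linarith) (by linarith)
        (by linarith) (by linarith)

end Core

/-! ### Directions in the plane and wedges -/

theorem inner_dir (t : ℝ) (x : Plane) : inner ℝ (dir t) x = cos t * x 0 + sin t * x 1 := by
  simp [dir, PiLp.inner_apply, Fin.sum_univ_two, mul_comm]

theorem norm_dir (t : ℝ) : ‖dir t‖ = 1 := by
  simp [dir, EuclideanSpace.norm_eq, Fin.sum_univ_two]

theorem dir_add_int_mul_two_pi (t : ℝ) (m : ℤ) : dir (t + m * (2 * π)) = dir t := by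
  simp [dir, cos_add_int_mul_two_pi, sin_add_int_mul_two_pi]

theorem dir_add_pi (t : ℝ) : dir (t + π) = -dir t := by
  ext i; fin_cases i <;> simp [dir]

theorem dir_add (s t : ℝ) : dir (s + t) = cos t • dir s + sin t • dir (s + π / 2) := by
  ext i
  fin_cases i <;> simp [dir, cos_add, sin_add] <;> ring

theorem exists_eq_dir {v : Plane} (hv : ‖v‖ = 1) : ∃ t, v = dir t := by
  have h : v 0 ^ 2 + v 1 ^ 2 = 1 := by
    have := EuclideanSpace.norm_sq_eq v
    simpa [Fin.sum_univ_two, hv] using this.symm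
  set z : ℂ := ⟨v 0, v 1⟩
  have hz : ‖z‖ = 1 := by
    rw [Complex.norm_def, Complex.normSq_apply, Real.sqrt_eq_one]
    linarith [h, sq (v 0), sq (v 1)]
  have hz0 : z ≠ 0 := by
    intro h0; simp [h0] at hz
  refine ⟨z.arg, ?_⟩
  ext i
  fin_cases i
  · simp [dir, Complex.cos_arg hz0, hz, z]
  · simp [dir, Complex.sin_arg, hz, z]

theorem cos_two_pi_div_three : cos (2 * π / 3) = -1 / 2 := by
  rw [show 2 * π / 3 = π - π / 3 by ring, cos_pi_sub, cos_pi_div_three]; ring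

theorem sin_two_pi_div_three : sin (2 * π / 3) = √3 / 2 := by
  rw [show 2 * π / 3 = π - π / 3 by ring, sin_pi_sub, sin_pi_div_three]

theorem cos_five_pi_div_six : cos (5 * π / 6) = -√3 / 2 := by
  rw [show 5 * π / 6 = π - π / 6 by ring, cos_pi_sub, cos_pi_div_six]; ring

theorem sin_five_pi_div_six : sin (5 * π / 6) = 1 / 2 := by
  rw [show 5 * π / 6 = π - π / 6 by ring, sin_pi_sub, sin_pi_div_six]

/-- The wedge of angle `2π/3` as an intersection of two half-planes. -/
theorem mem_wedge_of_inner {p q : Plane} {t φ : ℝ} (ht : dir t = dir (φ + 5 * π / 6))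
    (h₁ : inner ℝ (dir φ) (q - p) ≤ 0) (h₂ : 0 ≤ inner ℝ (dir (φ + 2 * π / 3)) (q - p)) :
    q ∈ wedge (2 * π / 3) p t := by
  rcases eq_or_ne q p with h | h
  · exact Or.inl h
  right
  set d := q - p with hd
  have hd0 : 0 < ‖d‖ := norm_pos_iff.2 (sub_ne_zero.2 h)
  set u := inner ℝ (dir φ) d with hu
  set w := inner ℝ (dir (φ + π / 2)) d with hw
  have hnorm : u ^ 2 + w ^ 2 = ‖d‖ ^ 2 := by
    rw [EuclideanSpace.norm_sq_eq, hu, hw, inner_dir, inner_dir, cos_add_pi_div_two,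
      sin_add_pi_div_two]
    simp only [Fin.sum_univ_two, norm_eq_abs, sq_abs]
    linear_combination (d 0 ^ 2 + d 1 ^ 2) * sin_sq_add_cos_sq φ
  have h3 : √3 ^ 2 = 3 := sq_sqrt (by norm_num)
  have h3' : 0 < √3 := by positivity
  rw [dir_add, cos_two_pi_div_three, sin_two_pi_div_three, inner_add_left, real_inner_smul_left,
    real_inner_smul_left, ← hu, ← hw] at h₂
  have hkey : ‖d‖ / 2 ≤ inner ℝ (dir t) d := by
    rw [ht, dir_add, cos_five_pi_div_six, sin_five_pi_div_six, inner_add_left,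
      real_inner_smul_left, real_inner_smul_left, ← hu, ← hw]
    -- `(w - √3 u)² - ‖d‖² = 2u(u - √3 w)`, a product of two nonpositive factors up to the 2.
    have hw' : u ≤ √3 * w := by linarith
    have hw'' : 0 ≤ w - √3 * u := by nlinarith
    have := abs_le_of_sq_le_sq' (a := ‖d‖) (b := w - √3 * u) (by nlinarith) hw''
    linarith [this.2]
  rw [InnerProductGeometry.angle, norm_dir, one_mul]
  calc arccos (inner ℝ (dir t) d / ‖d‖) ≤ arccos (1 / 2) := by
        apply arccos_le_arccos
        rw [le_div_iff₀ hd0]; linarith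
    _ = 2 * π / 3 / 2 := by
        rw [← cos_pi_div_three, arccos_cos (by positivity) (by linarith [pi_pos])]; ring

/-- A linear isometry of the plane is a rotation or a reflection. -/
theorem exists_map_dir (e : Plane ≃ₗᵢ[ℝ] Plane) :
    ∃ φ, (∀ t, e (dir (φ + t)) = dir t) ∨ ∀ t, e (dir (φ + t)) = dir (-t) := by
  obtain ⟨φ, hφ⟩ := exists_eq_dir (v := e.symm (dir 0)) (by simp [norm_dir])
  have hφ' : e (dir φ) = dir 0 := by rw [← hφ]; simp
  obtain ⟨ψ, hψ⟩ := exists_eq_dir (v := e (dir (φ + π / 2))) (by simp [norm_dir])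
  have horth : cos ψ = 0 := by
    have h₁ : inner ℝ (e (dir φ)) (e (dir (φ + π / 2))) = (0 : ℝ) := by
      rw [e.inner_map_map, inner_dir]
      simp [dir, cos_add_pi_div_two, sin_add_pi_div_two]; ring
    rw [hφ', hψ, inner_dir] at h₁
    simpa [dir] using h₁
  refine ⟨φ, ?_⟩
  have hs : sin ψ = 1 ∨ sin ψ = -1 := by
    have := sin_sq_add_cos_sq ψ
    rw [horth] at this
    exact mul_self_eq_one_iff.1 (by linarith)
  refine hs.imp (fun h t => ?_) (fun h t => ?_) <;>
  · rw [dir_add, map_add, map_smul, map_smul, hφ', hψ]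
    ext i
    fin_cases i <;> simp [dir, horth, h]

/-! ### Fans: three cyclically overlapping wedges -/

/-- The `k`-th of three directions spaced by 120 degrees, starting from `φ`. -/
noncomputable def triDir (φ : ℝ) (k : Fin 3) : Plane := dir (φ + (k : ℕ) * (2 * π / 3))

theorem triDir_add_one (φ : ℝ) (k : Fin 3) :
    triDir φ (k + 1) = dir (φ + (k : ℕ) * (2 * π / 3) + 2 * π / 3) := by
  fin_cases k
  · simp [triDir]
  · simp [triDir]; ring_nf
  · have := dir_add_int_mul_two_pi φ 1
    simp [triDir] at this ⊢
    rw [← this]; ring_nf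

theorem triDir_add (φ : ℝ) (k : Fin 3) : triDir (φ + 2 * π / 3) k = triDir φ (k + 1) := by
  rw [triDir_add_one, triDir]; ring_nf

theorem triDir_add_pi (φ : ℝ) (k : Fin 3) : triDir (φ + π) k = -triDir φ k := by
  rw [triDir, triDir, ← dir_add_pi]; ring_nf

theorem triDir_add_int_mul_two_pi (φ : ℝ) (m : ℤ) (k : Fin 3) :
    triDir (φ + m * (2 * π)) k = triDir φ k := by
  rw [triDir, triDir, add_right_comm, dir_add_int_mul_two_pi]

theorem triDir_sum (φ : ℝ) : triDir φ 0 + triDir φ 1 + triDir φ 2 = 0 := by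
  rw [show (2 : Fin 3) = 1 + 1 from rfl, triDir_add_one, triDir, triDir]
  ext i
  fin_cases i <;>
    simp [dir, cos_add, sin_add, cos_two_pi_div_three, sin_two_pi_div_three] <;> ring_nf <;>
    simp <;> ring

/-- The points `p k` carry the wedges cut out by consecutive directions of `triDir φ`, in such a
way that consecutive wedges overlap, and the cyclic sums of support values are ordered. -/
structure IsFan (θ : Plane → ℝ) (p : Fin 3 → Plane) (φ : ℝ) : Prop where
  orient : ∀ k : Fin 3, dir (θ (p k)) = dir (φ + (k : ℕ) * (2 * π / 3) + 5 * π / 6)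
  overlap : ∀ k, inner ℝ (triDir φ (k + 1)) (p k) ≤ inner ℝ (triDir φ (k + 1)) (p (k + 1))
  sum_one_le_sum_two :
    ∑ k, inner ℝ (triDir φ (k + 1)) (p k) ≤ ∑ k, inner ℝ (triDir φ (k + 2)) (p k)
  sum_two_le_sum_zero :
    ∑ k, inner ℝ (triDir φ (k + 2)) (p k) ≤ ∑ k, inner ℝ (triDir φ k) (p k)

theorem dir_fan_eq (φ : ℝ) (k : Fin 3) :
    dir (φ + (k : ℕ) * (2 * π / 3) + 5 * π / 6) =
      cos (5 * π / 6) • triDir φ k + sin (5 * π / 6) • triDir (φ + π / 2) k := by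
  rw [dir_add, triDir, triDir]; ring_nf

namespace IsFan

variable {θ : Plane → ℝ} {p : Fin 3 → Plane} {φ : ℝ}

theorem mem_wedge (h : IsFan θ p φ) {k : Fin 3} {q : Plane}
    (h₁ : inner ℝ (triDir φ k) (q - p k) ≤ 0)
    (h₂ : 0 ≤ inner ℝ (triDir φ (k + 1)) (q - p k)) :
    q ∈ wedge (2 * π / 3) (p k) (θ (p k)) := by
  rw [triDir_add_one] at h₂
  exact mem_wedge_of_inner (h.orient k) h₁ h₂

theorem add_int_mul_two_pi (h : IsFan θ p φ) (m : ℤ) : IsFan θ p (φ + m * (2 * π)) := by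
  constructor
  · intro k
    rw [h.orient, ← dir_add_int_mul_two_pi _ m]; ring_nf
  all_goals simp only [triDir_add_int_mul_two_pi]
  exacts [h.overlap, h.sum_one_le_sum_two, h.sum_two_le_sum_zero]

theorem rotate (h : IsFan θ p φ) : IsFan θ (fun k => p (k + 1)) (φ + 2 * π / 3) := by
  have e (f : Fin 3 → ℝ) : ∑ k, f (k + 1) = ∑ k, f k := Equiv.sum_comp (Equiv.addRight 1) f
  constructor
  · intro k
    rw [h.orient, dir_fan_eq, ← triDir_add, ← triDir_add (φ + π / 2), add_right_comm φ, ← dir_fan_eq]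
  all_goals simp only [triDir_add]
  · exact fun k => h.overlap (k + 1)
  · rw [e fun k => inner ℝ (triDir φ (k + 1)) (p k)]
    have := e fun k => inner ℝ (triDir φ (k + 2)) (p k)
    simp only [add_right_comm _ (1 : Fin 3) 2] at this
    rw [this]; exact h.sum_one_le_sum_two
  · rw [e fun k => inner ℝ (triDir φ k) (p k)]
    have := e fun k => inner ℝ (triDir φ (k + 2)) (p k)
    simp only [add_right_comm _ (1 : Fin 3) 2] at this
    rw [this]; exact h.sum_two_le_sum_zero

theorem exists_rotate (h : IsFan θ p φ) (m : ℤ) :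
    ∃ q, Set.range q = Set.range p ∧ IsFan θ q (φ + m * (2 * π / 3)) := by
  have up : ∀ q ψ, Set.range q = Set.range p → IsFan θ q ψ →
      ∃ q', Set.range q' = Set.range p ∧ IsFan θ q' (ψ + 2 * π / 3) := fun q ψ hq hψ =>
    ⟨fun k => q (k + 1), by rw [← hq]; exact (Equiv.addRight (1 : Fin 3)).surjective.range_comp q,
      hψ.rotate⟩
  induction m using Int.induction_on with
  | zero => exact ⟨p, rfl, by simpa using h⟩
  | succ m ih =>
    obtain ⟨q, hq, hf⟩ := ih
    obtain ⟨q', hq', hf'⟩ := up q _ hq hf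
    refine ⟨q', hq', ?_⟩
    convert! hf' using 1
    push_cast; ring
  | pred m ih =>
    obtain ⟨q, hq, hf⟩ := ih
    obtain ⟨q₁, hq₁, hf₁⟩ := up q _ hq hf
    obtain ⟨q₂, hq₂, hf₂⟩ := up q₁ _ hq₁ hf₁
    refine ⟨q₂, hq₂, ?_⟩
    -- One rotation back is two forward and a full turn back.
    convert! hf₂.add_int_mul_two_pi (-1) using 1
    push_cast; ring

/-- Two fans always have points that see each other. -/
theorem exists_mutual {q : Fin 3 → Plane} {ψ : ℝ} (hp : IsFan θ p φ) (hq : IsFan θ q ψ) :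
    ∃ x ∈ Set.range p, ∃ y ∈ Set.range q,
      x ∈ wedge (2 * π / 3) y (θ y) ∧ y ∈ wedge (2 * π / 3) x (θ x) := by
  have hpos : 0 < 2 * π / 3 := by positivity
  -- The shift by `π` accounts for viewing `p k` from `q j` instead of the reverse. The half-open
  -- window puts `τ` in `[0, 2π/3)`, whence `s ≥ 0` and `r > 0`.
  obtain ⟨m, ⟨hm₁, hm₂⟩, -⟩ := existsUnique_add_zsmul_mem_Ico hpos ψ (φ - π)
  obtain ⟨q', hqq, hq'⟩ := hq.exists_rotate m
  rw [← hqq]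
  rw [zsmul_eq_mul] at hm₁ hm₂
  set τ := ψ + m * (2 * π / 3) - (φ - π) with hτ
  rw [show ψ + m * (2 * π / 3) = φ + τ - π by rw [hτ]; ring] at hq'
  have hs : 0 ≤ sin τ := sin_nonneg_of_nonneg_of_le_pi (by linarith) (by linarith [pi_pos])
  have hr : 0 < sin (2 * π / 3 - τ) := sin_pos_of_pos_of_lt_pi (by linarith) (by linarith [pi_pos])
  have h3 : √3 ^ 2 = 3 := sq_sqrt (by norm_num)
  have h3' : 0 < √3 := by positivity
  have hneg : ∀ k, triDir (φ + τ - π) k = -triDir (φ + τ) k := by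
    intro k
    rw [eq_neg_iff_add_eq_zero, ← neg_eq_iff_add_eq_zero, ← triDir_add_pi, sub_add_cancel]
  have ov := hq'.overlap
  have le₁ := hq'.sum_one_le_sum_two
  have le₂ := hq'.sum_two_le_sum_zero
  have mw := fun k y => hq'.mem_wedge (k := k) (q := y)
  simp only [hneg, inner_neg_left, neg_le_neg_iff, Finset.sum_neg_distrib] at ov le₁ le₂ mw
  -- `r` and `s` are the coordinates of `dir τ` in the basis `dir 0`, `dir (2π/3)`.
  obtain ⟨k, j, h₁, h₂, h₃, h₄⟩ := exists_mem_sectors (n := triDir φ) (f := triDir (φ + τ))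
    (p := p) (q := q') (r := 2 / √3 * sin (2 * π / 3 - τ)) (s := 2 / √3 * sin τ) (by
      rw [sin_sub, cos_two_pi_div_three, sin_two_pi_div_three]
      field_simp
      nlinarith [sin_sq_add_cos_sq τ]) (by positivity) (by positivity) (triDir_sum φ) (by
      intro k
      rw [triDir_add_one, sin_sub, cos_two_pi_div_three, sin_two_pi_div_three, triDir,
        show φ + τ + (k : ℕ) * (2 * π / 3) = φ + (k : ℕ) * (2 * π / 3) + τ by ring, dir_add,
        dir_add _ (2 * π / 3), triDir, cos_two_pi_div_three, sin_two_pi_div_three, smul_add,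
        smul_smul, smul_smul, ← add_assoc, ← add_smul]
      congr 2
      · field_simp; ring_nf
      · field_simp)
    hp.overlap ov hp.sum_one_le_sum_two hp.sum_two_le_sum_zero le₁ le₂
  refine ⟨p k, ⟨k, rfl⟩, q' j, ⟨j, rfl⟩, mw j _ ?_ ?_, hp.mem_wedge h₁ h₂⟩
  · rw [← neg_sub, inner_neg_right]; linarith
  · rw [← neg_sub, inner_neg_right]; linarith

end IsFan

/-! ### Gadget orientations are fans -/

theorem forall_fin_three_iff {P : Fin 3 → Prop} : (∀ k, P k) ↔ P 0 ∧ P 1 ∧ P 2 :=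
  ⟨fun h => ⟨h 0, h 1, h 2⟩, fun h k => by fin_cases k <;> tauto⟩

namespace IsGadgetLabelling

variable {a b c : Plane}

theorem dist_a_c_le (h : IsGadgetLabelling a b c) : dist a c ≤ dist a b := by
  by_cases hc : Collinear ℝ {a, b, c}
  · exact h.degenerate hc
  · have hc' : ¬Collinear ℝ ({a, c, b} : Set Plane) := by rwa [Set.pair_comm]
    exact (angle_le_iff_dist_le hc').1 h.angle_b_le_angle_c

/-- A collinear triple has angle 0 or `π` at `a`; 0 is impossible for the largest of three angles
with sum `π`. -/
theorem angle_eq_pi_of_collinear (h : IsGadgetLabelling a b c) (hc : Collinear ℝ {a, b, c}) :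
    ∠ b a c = π := by
  have hc' : Collinear ℝ ({b, a, c} : Set Plane) := by rwa [Set.insert_comm]
  have hc'' : Collinear ℝ ({a, c, b} : Set Plane) := by rwa [Set.pair_comm]
  have hsum := angle_add_angle_add_angle_eq_pi c h.ab.symm
  rw [angle_comm b c a, angle_comm c a b] at hsum
  have h₁ := h.angle_b_le_angle_c
  have h₂ := h.angle_c_le_angle_a
  have hπ := pi_pos
  rcases collinear_iff_eq_or_eq_or_angle_eq_zero_or_angle_eq_pi.1 hc' with h' | h' | h' | h'
  · exact absurd h'.symm h.ab
  · exact absurd h'.symm h.ac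
  · linarith
  · exact h'

theorem dist_a_b_le (h : IsGadgetLabelling a b c) : dist a b ≤ dist b c := by
  by_cases hc : Collinear ℝ {a, b, c}
  · rw [dist_eq_add_dist_of_angle_eq_pi (h.angle_eq_pi_of_collinear hc), dist_comm a b]
    exact le_add_of_nonneg_right dist_nonneg
  · have hc' : ¬Collinear ℝ ({b, a, c} : Set Plane) := by rwa [Set.insert_comm]
    rw [dist_comm a b]
    refine (angle_le_iff_dist_le hc').1 ?_
    rw [angle_comm b c a]; exact h.angle_c_le_angle_a

end IsGadgetLabelling

theorem dist_sq_eq (x y : Plane) : dist x y ^ 2 = (x 0 - y 0) ^ 2 + (x 1 - y 1) ^ 2 := by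
  rw [EuclideanSpace.dist_eq, sq_sqrt (by positivity), Fin.sum_univ_two]
  simp only [Real.dist_eq, sq_abs]

/-- In a frame given by an isometry, inner products with directions have the standard form up to
the sign of the second coordinate. -/
theorem exists_frame (e : Plane ≃ᵃⁱ[ℝ] Plane) :
    ∃ φ σ : ℝ, (σ = 1 ∨ σ = -1) ∧
      (∀ t, e.linearIsometryEquiv (dir (φ + σ * t)) = dir t) ∧
      ∀ t x y, inner ℝ (dir (φ + t)) (x - y) =
        cos t * (e x 0 - e y 0) + σ * sin t * (e x 1 - e y 1) := by
  have key : ∀ u x y : Plane, inner ℝ u (x - y) =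
      (inner ℝ (e.linearIsometryEquiv u) (e x - e y) : ℝ) := by
    intro u x y
    have := e.map_vsub x y
    simp only [vsub_eq_sub] at this
    rw [← this, LinearIsometryEquiv.inner_map_map]
  obtain ⟨φ, h | h⟩ := exists_map_dir e.linearIsometryEquiv
  · refine ⟨φ, 1, Or.inl rfl, by simpa using h, fun t x y => ?_⟩
    rw [key, h, inner_dir]; simp
  · refine ⟨φ, -1, Or.inr rfl, fun t => by rw [h]; simp, fun t x y => ?_⟩
    rw [key, h, inner_dir]; simp

/-- A point that sees and is seen by each point of `S`. -/
def IsHub (θ : Plane → ℝ) (S : Set Plane) (b : Plane) : Prop :=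
  ∀ x ∈ S, x ∈ wedge (2 * π / 3) b (θ b) ∧ b ∈ wedge (2 * π / 3) x (θ x)

/-- Put `b = (0, 0)`, `c = (w, 0)`, `a = (x, y)` in the drawing. From `|ac| ≤ |ab| ≤ |bc|` come `w/2
≤ x ≤ w` and `0 ≤ y ≤ √3 x`; every fan and hub inequality is then linear in `√3 x`, `√3 w`, `y`.
Starting the normals at `-150°` makes `b` the point of index 0. -/
theorem IsGadgetOriented.exists_isFan {S : Set Plane} {θ : Plane → ℝ}
    (h : IsGadgetOriented S θ) :
    ∃ p φ, Set.range p = S ∧ IsFan θ p φ ∧ IsHub θ S (p 0) := by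
  obtain ⟨a, b, c, rfl, hl, e, hd, ha, hb, hc⟩ := h
  obtain ⟨φ, σ, hσ, hmap, hinner⟩ := exists_frame e
  have orient : ∀ {x : Plane} {t : ℝ}, e.linearIsometryEquiv (dir (θ x)) = dir t →
      dir (θ x) = dir (φ + σ * t) := fun h =>
    e.linearIsometryEquiv.injective (h.trans (hmap _).symm)
  replace ha := orient ha
  replace hb := orient hb
  replace hc := orient hc
  have hw := hd.left
  have hy := hd.not_below
  have hcb := hd.horizontal
  have hac := pow_le_pow_left₀ dist_nonneg hl.dist_a_c_le 2
  have hab := pow_le_pow_left₀ dist_nonneg hl.dist_a_b_le 2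
  rw [← e.dist_map a, ← e.dist_map a, dist_sq_eq, dist_sq_eq, ← hcb] at hac
  rw [← e.dist_map a, ← e.dist_map b, dist_sq_eq, dist_sq_eq, ← hcb] at hab
  have iab := fun t => hinner t a b
  have icb := fun t => hinner t c b
  simp only [inner_sub_right, ← hcb] at iab icb
  obtain ⟨x, hx⟩ : ∃ x, x = e a 0 - e b 0 := ⟨_, rfl⟩
  obtain ⟨y, hy'⟩ : ∃ y, y = e a 1 - e b 1 := ⟨_, rfl⟩
  obtain ⟨w, hw'⟩ : ∃ w, w = e c 0 - e b 0 := ⟨_, rfl⟩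
  simp only [← hx, ← hy', ← hw', sub_self, mul_zero, add_zero] at iab icb
  rw [← hx, ← hy', show e a 0 - e c 0 = x - w by rw [hx, hw']; ring] at hac
  rw [← hx, ← hy', show e b 0 - e c 0 = -w by rw [hw']; ring] at hab
  replace hw : 0 < w := by linarith
  replace hy : 0 ≤ y := by linarith
  have hx₁ : w ≤ 2 * x := by nlinarith
  have hx₂ : x ≤ w := by nlinarith
  have h3 : √3 ^ 2 = 3 := sq_sqrt (by norm_num)
  have h3' : 0 < √3 := by positivity
  -- `y² ≤ w² - x² ≤ 3x²`: the angle at `b` is at most 60°.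
  have hyx : y ≤ √3 * x := abs_le_of_sq_le_sq' (by nlinarith) (by nlinarith) |>.2
  have t₀ : triDir (φ - 5 * π / 6) 0 = dir (φ + -(5 * π / 6)) := by
    rw [triDir]; simp; ring_nf
  have t₁ : triDir (φ - 5 * π / 6) 1 = dir (φ + -(π / 6)) := by
    rw [triDir]; simp; ring_nf
  have t₂ : triDir (φ - 5 * π / 6) 2 = dir (φ + π / 2) := by
    rw [triDir]; simp; ring_nf
  have hsum : ∀ v : Plane, inner ℝ (dir (φ + -(5 * π / 6))) v + inner ℝ (dir (φ + -(π / 6))) v +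
      inner ℝ (dir (φ + π / 2)) v = 0 := by
    intro v
    rw [← t₀, ← t₁, ← t₂, ← inner_add_left, ← inner_add_left, triDir_sum, inner_zero_left]
  have a₀ := iab (-(5 * π / 6))
  have a₁ := iab (-(π / 6))
  have a₂ := iab (π / 2)
  have c₀ := icb (-(5 * π / 6))
  have c₁ := icb (-(π / 6))
  have c₂ := icb (π / 2)
  simp only [cos_neg, sin_neg, cos_five_pi_div_six, sin_five_pi_div_six, cos_pi_div_six,
    sin_pi_div_six, cos_pi_div_two, sin_pi_div_two] at a₀ a₁ a₂ c₀ c₁ c₂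
  have sa := hsum a
  have sb := hsum b
  have sc := hsum c
  have s1 : √3 * w ≤ √3 * (2 * x) := mul_le_mul_of_nonneg_left hx₁ h3'.le
  have s2 : √3 * x ≤ √3 * w := mul_le_mul_of_nonneg_left hx₂ h3'.le
  have s3 : 0 < √3 * w := by positivity
  have e22 : (2 : Fin 3) + 2 = 1 := rfl
  have e12 : (1 : Fin 3) + 2 = 0 := rfl
  have e21 : (2 : Fin 3) + 1 = 0 := rfl
  have e11 : (1 : Fin 3) + 1 = 2 := rfl
  rcases hσ with rfl | rfl
  · have hf : IsFan θ ![b, c, a] (φ - 5 * π / 6) := by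
      constructor
      · simp only [forall_fin_three_iff]
        refine ⟨?_, ?_, ?_⟩ <;> simp [hb, hc, ha] <;> ring_nf
      all_goals
        simp [forall_fin_three_iff, Fin.sum_univ_three, e22, e12, e21, e11, t₀, t₁, t₂]
      · refine ⟨?_, ?_, ?_⟩ <;> linarith
      · linarith
      · linarith
    refine ⟨_, _, ?_, hf, (?_ : IsHub θ _ b)⟩
    · ext z; simp [Matrix.range_cons]; tauto
    · have m₀ := fun q => hf.mem_wedge (k := 0) (q := q)
      have m₁ := fun q => hf.mem_wedge (k := 1) (q := q)
      have m₂ := fun q => hf.mem_wedge (k := 2) (q := q)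
      simp [e21, e11, t₀, t₁, t₂, inner_sub_right] at m₀ m₁ m₂
      rintro z (rfl | rfl | rfl)
      · exact ⟨m₀ _ (by linarith) (by linarith), m₂ _ (by linarith) (by linarith)⟩
      · exact ⟨Or.inl rfl, Or.inl rfl⟩
      · exact ⟨m₀ _ (by linarith) (by linarith), m₁ _ (by linarith) (by linarith)⟩
  -- A reflection reverses the cyclic order, so `a` and `c` change places.
  · have hf : IsFan θ ![b, a, c] (φ - 5 * π / 6) := by
      constructor
      · simp only [forall_fin_three_iff]
        refine ⟨?_, ?_, ?_⟩
        · simp [hb]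
        · simp only [Matrix.cons_val_one, Matrix.cons_val_zero, ha]
          rw [← dir_add_int_mul_two_pi _ 1]
          simp; ring_nf
        · simp only [Matrix.cons_val, hc]
          rw [← dir_add_int_mul_two_pi _ 1]
          simp; ring_nf
      all_goals
        simp [forall_fin_three_iff, Fin.sum_univ_three, e22, e12, e21, e11, t₀, t₁, t₂]
      · refine ⟨?_, ?_, ?_⟩ <;> linarith
      · linarith
      · linarith
    refine ⟨_, _, ?_, hf, (?_ : IsHub θ _ b)⟩
    · ext z; simp [Matrix.range_cons]; tauto
    · have m₀ := fun q => hf.mem_wedge (k := 0) (q := q)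
      have m₁ := fun q => hf.mem_wedge (k := 1) (q := q)
      have m₂ := fun q => hf.mem_wedge (k := 2) (q := q)
      simp [e21, e11, t₀, t₁, t₂, inner_sub_right] at m₀ m₁ m₂
      rintro z (rfl | rfl | rfl)
      · exact ⟨m₀ _ (by linarith) (by linarith), m₁ _ (by linarith) (by linarith)⟩
      · exact ⟨Or.inl rfl, Or.inl rfl⟩
      · exact ⟨m₀ _ (by linarith) (by linarith), m₂ _ (by linarith) (by linarith)⟩

/-! ### Connectedness of the induced graph -/

theorem inducedGraph_reachable {α : ℝ} {S : Set Plane} {θ : Plane → ℝ} {x y : S}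
    (h₁ : (x : Plane) ∈ wedge α y (θ y)) (h₂ : (y : Plane) ∈ wedge α x (θ x)) :
    (inducedGraph α S θ).Reachable x y := by
  by_cases h : x = y
  · rw [h]
  · exact SimpleGraph.Adj.reachable ⟨h, h₁, h₂⟩

theorem mainTheorem1 (S₁ S₂ : Set Plane) (θ : Plane → ℝ)
    (h₁ : IsGadgetOriented S₁ θ) (h₂ : IsGadgetOriented S₂ θ) :
    (inducedGraph (2 * π / 3) (S₁ ∪ S₂) θ).Connected ∧
      ∃ p ∈ S₁, ∃ q ∈ S₂,
        p ∈ wedge (2 * π / 3) q (θ q) ∧ q ∈ wedge (2 * π / 3) p (θ p) := by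
  obtain ⟨p, φ, rfl, hp, hubp⟩ := h₁.exists_isFan
  obtain ⟨q, ψ, rfl, hq, hubq⟩ := h₂.exists_isFan
  obtain ⟨x, hx, y, hy, hxy, hyx⟩ := hp.exists_mutual hq
  refine ⟨?_, x, hx, y, hy, hxy, hyx⟩
  set G := inducedGraph (2 * π / 3) (Set.range p ∪ Set.range q) θ
  have rp : ∀ z (hz : z ∈ Set.range p), G.Reachable ⟨z, Or.inl hz⟩ ⟨p 0, Or.inl ⟨0, rfl⟩⟩ :=
    fun z hz => inducedGraph_reachable (hubp z hz).1 (hubp z hz).2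
  have rq : ∀ z (hz : z ∈ Set.range q), G.Reachable ⟨z, Or.inr hz⟩ ⟨q 0, Or.inr ⟨0, rfl⟩⟩ :=
    fun z hz => inducedGraph_reachable (hubq z hz).1 (hubq z hz).2
  have hpq : G.Reachable ⟨q 0, Or.inr ⟨0, rfl⟩⟩ ⟨p 0, Or.inl ⟨0, rfl⟩⟩ :=
    (rq y hy).symm.trans <| (inducedGraph_reachable hyx hxy).trans (rp x hx)
  have all : ∀ z, G.Reachable z ⟨p 0, Or.inl ⟨0, rfl⟩⟩ := by
    rintro ⟨z, hz | hz⟩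
    · exact rp z hz
    · exact (rq z hz).trans hpq
  have : Nonempty ↑(Set.range p ∪ Set.range q) := ⟨⟨x, Or.inl hx⟩⟩
  exact ⟨fun u v => (all u).trans (all v).symm⟩
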